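/- A pentagonal complex is a 2-dimensional CW-complex whose 2-cells (tiles) are combinatorial pentagons. Its subdivision $\omega(A)$ is obtained by cutting every edge at a midpoint, putting a central pentagon into every tile, and joining the $i$-th vertex of the central pentagon to the midpoint of the $i$-th side of the tile, so that each tile is cut into six pentagons. Let $K_0$ be a single pentagon, $K_n=\omega^n(K_0)$, embed $K_n$ in $K_{n+1}$ by taking the central pentagon to the central pentagon (that is, $\omega^n$ applied to the inclusion of $K_0$ as the central pentagon of $K_1$), and let $K=\varinjlim K_n$. Fix any decoration of $K$, that is, a labelling of its flags (vertex, edge, tile) by the elements of some set. A (decorated) combinatorial tiling is a decorated pentagonal complex with embedded tiles, every cell of which lies in a tile, and which is homeomorphic to the plane. It is locally isomorphic to $K$ if for each finite set $P$ of its tiles there is a finite set $Q$ of tiles of $K$ such that the subcomplexes formed by $P$ and by $Q$ are isomorphic by an isomorphism that preserves cells and decorations. For a combinatorial tiling $L$ let $L_{\mathrm{aff}}$ be the space obtained by pasting together Euclidean regular pentagons of edge-length one in the pattern of $L$. Let $\Omega$ (the continuous hull) be the set of classes $[L,x]$, where $L$ is a combinatorial tiling locally isomorphic to $K$ and $x\in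 L_{\mathrm{aff}}$, and where $[L,x]=[L',x']$ means that there is a homeomorphism $\phi:L_{\mathrm{aff}}\to L'_{\mathrm{aff}}$ that preserves cells and decorations and is isometric on each cell, with $\phi(x)=x'$. Let $\Xi$ (the discrete hull) be the set of classes $[L,v]$, where $L$ is a combinatorial tiling locally isomorphic to $K$ and $v$ is a vertex of $L$, and where $[L,v]=[L',v']$ means that there is a combinatorial isomorphism $L\to L'$ that preserves decorations and takes $v$ to $v'$. Let $$R=\{([L,x],[L,x'])\in\Omega\times\Omega \mid x,x'\in L_{\mathrm{aff}}\},\qquad R'=\{([L,v],[L,v'])\in\Xi\times\Xi \mid v,v' \text{ vertices of } L\}.$$ Then $R$ is an equivalence relation on $\Omega$; the map $\Xi\to\Omega$, $[L,v]\mapsto[L,v]$, is well defined and injective, so that $\Xi$ may be regarded as a subset of $\Omega$; $\Xi$ is a full transversal to $\Omega$ relative to $R$, that is, for each $\xi\in\Omega$ the set $[\xi]_R\cap\Xi$ is countable and nonempty; and the restriction $R_\Xi=\{(a,b)\in\Xi\times\Xi\mid (a,b)\in R\}$ equals $R'$. -/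

import Mathlib

universe u

/-! ### Pentagonal complexes -/

/-- A two-dimensional cell complex all of whose 2-cells (tiles) are pentagons, given by its
vertices, edges and tiles. Going once around the boundary of the tile `t` one meets the vertices
`corner t 0, …, corner t 4`; `side t i` is the edge from `corner t i` to `corner t (i + 1)`
(indices modulo `5`). The numbering and the direction are auxiliary: isomorphisms ignore them. -/
structure PentComplex : Type 1 where
  /-- the vertices (0-cells) -/
  V : Type
  /-- the edges (1-cells) -/
  E : Type
  /-- the tiles (2-cells) -/
  T : Type
  /-- the endpoints of an edge -/
  ends : E → Sym2 V
  /-- the vertices of a tile, in cyclic order -/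
  corner : T → Fin 5 → V
  /-- the edges of a tile, in cyclic order -/
  side : T → Fin 5 → E
  ends_side : ∀ t i, ends (side t i) = s(corner t i, corner t (i + 1))

namespace PentComplex

/-- Maps of complexes that respect the numberings; they are used to build the tiling `K`. -/
structure Hom (A B : PentComplex) where
  onV : A.V → B.V
  onE : A.E → B.E
  onT : A.T → B.T
  ends_map : ∀ e, B.ends (onE e) = (A.ends e).map onV
  corner_map : ∀ t i, B.corner (onT t) i = onV (A.corner t i)
  side_map : ∀ t i, B.side (onT t) i = onE (A.side t i)

/-! ### The subdivision rule

Every pentagon is replaced by a half-dodecahedron: each edge is cut in two by a midpoint, a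
central pentagon is put into the tile, and its vertices `c 0, …, c 4` are joined to the midpoints
of the sides `0, …, 4`. So each tile is cut into six pentagons. -/

/-- vertices: the old vertices, the midpoints of the old edges, the vertices of the central
pentagons -/
abbrev SubV (A : PentComplex) : Type := A.V ⊕ (A.E ⊕ (A.T × Fin 5))

/-- edges: the half-edges `(e, v)` from `v` to the midpoint of `e`, the spokes from the midpoint of
a side to the central pentagon, and the edges of the central pentagons -/
abbrev SubE (A : PentComplex) : Type :=
  {p : A.E × A.V // p.2 ∈ A.ends p.1} ⊕ ((A.T × Fin 5) ⊕ (A.T × Fin 5))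

/-- tiles: the central pentagon `(t, none)` of `t`, and the pentagon `(t, some i)` at the `i`-th
vertex of `t` -/
abbrev SubT (A : PentComplex) : Type := A.T × Option (Fin 5)

abbrev subOld (A : PentComplex) (v : A.V) : A.SubV := Sum.inl v
abbrev subMid (A : PentComplex) (e : A.E) : A.SubV := Sum.inr (Sum.inl e)
abbrev subCen (A : PentComplex) (t : A.T) (i : Fin 5) : A.SubV := Sum.inr (Sum.inr (t, i))
abbrev subHalf (A : PentComplex) (e : A.E) (v : A.V) (h : v ∈ A.ends e) : A.SubE :=
  Sum.inl ⟨(e, v), h⟩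
abbrev subSpoke (A : PentComplex) (t : A.T) (i : Fin 5) : A.SubE := Sum.inr (Sum.inl (t, i))
abbrev subInner (A : PentComplex) (t : A.T) (i : Fin 5) : A.SubE := Sum.inr (Sum.inr (t, i))

def subEnds (A : PentComplex) : A.SubE → Sym2 A.SubV
  | Sum.inl p => s(A.subOld p.1.2, A.subMid p.1.1)
  | Sum.inr (Sum.inl p) => s(A.subMid (A.side p.1 p.2), A.subCen p.1 p.2)
  | Sum.inr (Sum.inr p) => s(A.subCen p.1 p.2, A.subCen p.1 (p.2 + 1))

def subCorner (A : PentComplex) : A.SubT → Fin 5 → A.SubV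
  | (t, none), k => A.subCen t k
  | (t, some i), k =>
    ![A.subOld (A.corner t i), A.subMid (A.side t i), A.subCen t i, A.subCen t (i - 1),
      A.subMid (A.side t (i - 1))] k

theorem corner_mem_ends (A : PentComplex) (t : A.T) (i : Fin 5) :
    A.corner t i ∈ A.ends (A.side t i) := by
  rw [A.ends_side]; exact Sym2.mem_mk_left _ _

theorem corner_mem_ends' (A : PentComplex) (t : A.T) (i : Fin 5) :
    A.corner t i ∈ A.ends (A.side t (i - 1)) := by
  rw [A.ends_side, sub_add_cancel]; exact Sym2.mem_mk_right _ _

def subSide (A : PentComplex) : A.SubT → Fin 5 → A.SubE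
  | (t, none), k => A.subInner t k
  | (t, some i), k =>
    ![A.subHalf (A.side t i) (A.corner t i) (A.corner_mem_ends t i), A.subSpoke t i,
      A.subInner t (i - 1), A.subSpoke t (i - 1),
      A.subHalf (A.side t (i - 1)) (A.corner t i) (A.corner_mem_ends' t i)] k

/-- The subdivided complex `ω(A)`. -/
def subdiv (A : PentComplex) : PentComplex where
  V := A.SubV
  E := A.SubE
  T := A.SubT
  ends := A.subEnds
  corner := A.subCorner
  side := A.subSide
  ends_side := by
    rintro ⟨t, _ | i⟩ k
    · rfl
    · fin_cases k <;> simp [subSide, subCorner, subEnds, Sym2.eq_swap]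

/-- The map of subdivided complexes induced by a map of complexes. -/
def Hom.subdiv {A B : PentComplex} (f : Hom A B) : Hom A.subdiv B.subdiv where
  onV := Sum.map f.onV (Sum.map f.onE (Prod.map f.onT id))
  onE := Sum.map
    (fun p => ⟨(f.onE p.1.1, f.onV p.1.2), by
      rw [f.ends_map]; exact Sym2.mem_map.2 ⟨_, p.2, rfl⟩⟩)
    (Sum.map (Prod.map f.onT id) (Prod.map f.onT id))
  onT := Prod.map f.onT id
  ends_map := by
    rintro (p | p | p) <;> simp [PentComplex.subdiv, subEnds, f.side_map, Prod.map]
  corner_map := by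
    rintro ⟨t, _ | i⟩ k
    · rfl
    · fin_cases k <;> simp [PentComplex.subdiv, subCorner, f.side_map, f.corner_map]
  side_map := by
    rintro ⟨t, _ | i⟩ k
    · rfl
    · fin_cases k <;> simp [PentComplex.subdiv, subSide, f.side_map, f.corner_map]

/-! ### The pentagonal tiling `K` -/

/-- The combinatorial pentagon `K₀`. -/
def pentagon : PentComplex where
  V := Fin 5
  E := Fin 5
  T := Unit
  ends i := s(i, i + 1)
  corner _ i := i
  side _ i := i
  ends_side _ _ := rfl

/-- The supertile `K n = ω^n(K₀)`. -/
def supertile : ℕ → PentComplex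
  | 0 => pentagon
  | n + 1 => (supertile n).subdiv

/-- The embedding of `K₀` as the central pentagon of `ω(K₀)`. -/
def pentagonIncl : Hom pentagon pentagon.subdiv where
  onV i := pentagon.subCen () i
  onE i := pentagon.subInner () i
  onT _ := ((), none)
  ends_map _ := rfl
  corner_map _ _ := rfl
  side_map _ _ := rfl

/-- The embedding of `K n` into `K (n + 1)` that takes the central pentagon to the central
pentagon. -/
def supertileIncl : (n : ℕ) → Hom (supertile n) (supertile (n + 1))
  | 0 => pentagonIncl
  | n + 1 => (supertileIncl n).subdiv

/-- The direct limit of a sequence of sets. -/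
def SeqLim (X : ℕ → Type) (f : ∀ n, X n → X (n + 1)) : Type :=
  Quot (fun a b : Σ n, X n => b = ⟨a.1 + 1, f a.1 a.2⟩)

def SeqLim.mk {X : ℕ → Type} (f : ∀ n, X n → X (n + 1)) (n : ℕ) (x : X n) : SeqLim X f :=
  Quot.mk _ ⟨n, x⟩

theorem SeqLim.mk_succ {X : ℕ → Type} (f : ∀ n, X n → X (n + 1)) (n : ℕ) (x : X n) :
    SeqLim.mk f (n + 1) (f n x) = SeqLim.mk f n x :=
  (Quot.sound (r := fun a b : Σ n, X n => b = ⟨a.1 + 1, f a.1 a.2⟩)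
    (a := ⟨n, x⟩) (b := ⟨n + 1, f n x⟩) rfl).symm

/-- The direct limit of a sequence of complexes: the vertices, the edges and the tiles are the
direct limits of those of the terms. -/
def seqLim (X : ℕ → PentComplex) (f : ∀ n, Hom (X n) (X (n + 1))) : PentComplex where
  V := SeqLim (fun n => (X n).V) (fun n => (f n).onV)
  E := SeqLim (fun n => (X n).E) (fun n => (f n).onE)
  T := SeqLim (fun n => (X n).T) (fun n => (f n).onT)
  ends := Quot.lift
    (fun a => ((X a.1).ends a.2).map (SeqLim.mk (fun n => (f n).onV) a.1)) (by
      rintro ⟨n, e⟩ _ rfl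
      simp only [(f n).ends_map, Sym2.map_map]
      congr 1
      funext v
      exact (SeqLim.mk_succ (fun n => (f n).onV) n v).symm)
  corner := Quot.lift
    (fun a i => SeqLim.mk (fun n => (f n).onV) a.1 ((X a.1).corner a.2 i)) (by
      rintro ⟨n, t⟩ _ rfl
      funext i
      simp only [(f n).corner_map]
      exact (SeqLim.mk_succ (fun n => (f n).onV) n _).symm)
  side := Quot.lift
    (fun a i => SeqLim.mk (fun n => (f n).onE) a.1 ((X a.1).side a.2 i)) (by
      rintro ⟨n, t⟩ _ rfl
      funext i
      simp only [(f n).side_map]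
      exact (SeqLim.mk_succ (fun n => (f n).onE) n _).symm)
  ends_side := by
    rintro ⟨n, t⟩ i
    simp only [SeqLim.mk, (X n).ends_side, Sym2.map_mk]

/-- The combinatorial pentagonal tiling `K` (without decorations). -/
def tilingK : PentComplex := seqLim supertile supertileIncl

/-! ### The piecewise affine realization -/

/-- The vertices of the regular pentagon with centre `0` and edges of length one. -/
noncomputable def regVertex (i : Fin 5) : ℂ :=
  ((1 / (2 * Real.sin (Real.pi / 5)) : ℝ) : ℂ) *
    Complex.exp (2 * Real.pi * Complex.I * ((i : ℕ) : ℂ) / 5)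

/-- The closed regular pentagon with edges of length one, with its Euclidean metric. -/
abbrev RegPentagon : Type := convexHull ℝ (Set.range regVertex)

/-- The point on the `i`-th side of the regular pentagon at distance `s` from its vertex `i`. -/
noncomputable def regSide (i : Fin 5) (s : ℝ) : ℂ :=
  AffineMap.lineMap (regVertex i) (regVertex (i + 1)) s

/-- How the regular pentagons, one for each tile, are pasted together: along the vertices and edges
that the tiles have in common. -/
inductive Glue (A : PentComplex) :
    (Σ _ : A.T, RegPentagon) → (Σ _ : A.T, RegPentagon) → Prop
  | vertex (t t' : A.T) (i j : Fin 5) (p p' : RegPentagon)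
      (h : A.corner t i = A.corner t' j) (hp : p.1 = regVertex i) (hp' : p'.1 = regVertex j) :
      Glue A ⟨t, p⟩ ⟨t', p'⟩
  | parallel (t t' : A.T) (i j : Fin 5) (s : ℝ) (p p' : RegPentagon)
      (h : A.side t i = A.side t' j) (h₀ : A.corner t i = A.corner t' j)
      (h₁ : A.corner t (i + 1) = A.corner t' (j + 1)) (hs : s ∈ Set.Icc (0 : ℝ) 1)
      (hp : p.1 = regSide i s) (hp' : p'.1 = regSide j s) :
      Glue A ⟨t, p⟩ ⟨t', p'⟩
  | opposite (t t' : A.T) (i j : Fin 5) (s : ℝ) (p p' : RegPentagon)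
      (h : A.side t i = A.side t' j) (h₀ : A.corner t i = A.corner t' (j + 1))
      (h₁ : A.corner t (i + 1) = A.corner t' j) (hs : s ∈ Set.Icc (0 : ℝ) 1)
      (hp : p.1 = regSide i s) (hp' : p'.1 = regSide j (1 - s)) :
      Glue A ⟨t, p⟩ ⟨t', p'⟩

/-- The space `A_aff`: unit regular pentagons pasted together in the pattern of `A`. -/
def Aff (A : PentComplex) : Type := Quot A.Glue

/-- The weak (quotient) topology, that is, the topology of `A` as a CW-complex. -/
instance (A : PentComplex) : TopologicalSpace A.Aff :=
  inferInstanceAs (TopologicalSpace (Quot A.Glue))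

/-- The characteristic map of the tile `t`. -/
def pt (A : PentComplex) (t : A.T) (p : RegPentagon) : A.Aff := Quot.mk _ ⟨t, p⟩

/-- The 0-cell `v`, as a (one-point) subset of `A_aff`. -/
def vertexCell (A : PentComplex) (v : A.V) : Set A.Aff :=
  {x | ∃ (t : A.T) (i : Fin 5) (p : RegPentagon),
    A.corner t i = v ∧ p.1 = regVertex i ∧ A.pt t p = x}

/-- The closed 1-cell `e`, as a subset of `A_aff`. -/
def edgeCell (A : PentComplex) (e : A.E) : Set A.Aff :=
  {x | ∃ (t : A.T) (i : Fin 5) (s : ℝ) (p : RegPentagon),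
    A.side t i = e ∧ s ∈ Set.Icc (0 : ℝ) 1 ∧ p.1 = regSide i s ∧ A.pt t p = x}

/-- A combinatorial tiling of the plane by pentagons. -/
structure IsTiling (A : PentComplex) : Prop where
  /-- the tiles are embedded pentagons -/
  corner_injective : ∀ t, Function.Injective (A.corner t)
  /-- the tiles cover the complex -/
  exists_corner_eq : ∀ v, ∃ t i, A.corner t i = v
  exists_side_eq : ∀ e, ∃ t i, A.side t i = e
  /-- the space is homeomorphic to the plane -/
  homeo_plane : Nonempty (A.Aff ≃ₜ ℂ)

end PentComplex

/-! ### Decorated complexes and their isomorphisms -/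

/-- A pentagonal complex with decorations. The decoration is a labelling of the flags (vertex, edge,
tile), with the vertex on the edge and the edge on the tile; the value of `dec` at other triples has
no meaning. Labels of cells and markings drawn in the tiles, symmetric or not, are of this kind. -/
structure DecComplex (D : Type u) extends PentComplex where
  dec : V → E → T → D

namespace DecComplex

variable {D : Type u}

/-- Cell-preserving, decoration-preserving isomorphisms of complexes: dimension-preserving bijections
of the cells that respect incidence and decorations. -/
structure Iso (A B : DecComplex D) where
  onV : A.V ≃ B.V
  onE : A.E ≃ B.E
  onT : A.T ≃ B.T
  ends_map : ∀ e, B.ends (onE e) = (A.ends e).map onV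
  sides_map : ∀ t, Set.range (B.side (onT t)) = onE '' Set.range (A.side t)
  dec_map : ∀ v e t, v ∈ A.ends e → e ∈ Set.range (A.side t) →
    B.dec (onV v) (onE e) (onT t) = A.dec v e t

def Iso.refl (A : DecComplex D) : Iso A A where
  onV := Equiv.refl _
  onE := Equiv.refl _
  onT := Equiv.refl _
  ends_map e := by simp
  sides_map t := by simp
  dec_map v e t _ _ := rfl

def Iso.trans {A B C : DecComplex D} (f : Iso A B) (g : Iso B C) : Iso A C where
  onV := f.onV.trans g.onV
  onE := f.onE.trans g.onE
  onT := f.onT.trans g.onT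
  ends_map e := by simp [g.ends_map, f.ends_map, Sym2.map_map]
  sides_map t := by
    simp only [Equiv.trans_apply, Equiv.coe_trans, g.sides_map, f.sides_map, Set.image_comp]
  dec_map v e t h h' := by
    have h1 : f.onV v ∈ B.ends (f.onE e) := by
      rw [f.ends_map]; exact Sym2.mem_map.2 ⟨v, h, rfl⟩
    have h2 : f.onE e ∈ Set.range (B.side (f.onT t)) := by
      rw [f.sides_map]; exact ⟨e, h', rfl⟩
    exact (g.dec_map _ _ _ h1 h2).trans (f.dec_map v e t h h')

def Iso.symm {A B : DecComplex D} (f : Iso A B) : Iso B A where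
  onV := f.onV.symm
  onE := f.onE.symm
  onT := f.onT.symm
  ends_map e := by
    obtain ⟨e, rfl⟩ := f.onE.surjective e
    rw [f.ends_map, Sym2.map_map]; simp
  sides_map t := by
    obtain ⟨t, rfl⟩ := f.onT.surjective t
    rw [f.sides_map, Set.image_image]; simp
  dec_map v e t h h' := by
    obtain ⟨v, rfl⟩ := f.onV.surjective v
    obtain ⟨e, rfl⟩ := f.onE.surjective e
    obtain ⟨t, rfl⟩ := f.onT.surjective t
    rw [f.ends_map, Sym2.mem_map] at h
    obtain ⟨w, hw, hwv⟩ := h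
    obtain rfl := f.onV.injective hwv
    rw [f.sides_map] at h'
    obtain ⟨e', he', hee⟩ := h'
    obtain rfl := f.onE.injective hee
    simpa using (f.dec_map _ _ _ hw he').symm

/-- The subcomplex that consists of the tiles in `S` with their edges and vertices. -/
def restrict (A : DecComplex D) (S : Set A.T) : DecComplex D where
  V := {v : A.V // ∃ t ∈ S, ∃ i, A.corner t i = v}
  E := {e : A.E // ∃ t ∈ S, ∃ i, A.side t i = e}
  T := S
  ends e := (A.ends e.1).attachWith (by
    obtain ⟨e, t, ht, i, rfl⟩ := e
    intro v hv
    rw [A.ends_side, Sym2.mem_iff] at hv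
    rcases hv with rfl | rfl
    · exact ⟨t, ht, i, rfl⟩
    · exact ⟨t, ht, i + 1, rfl⟩)
  corner t i := ⟨A.corner t.1 i, t.1, t.2, i, rfl⟩
  side t i := ⟨A.side t.1 i, t.1, t.2, i, rfl⟩
  ends_side t i := by
    apply Sym2.map.injective Subtype.val_injective
    simp [A.ends_side]
  dec v e t := A.dec v.1 e.1 t.1

/-- `L` is locally isomorphic to `K`: for every patch (finite set of tiles, regarded as a subcomplex)
`P` of `L` there is an isomorphic patch `Q` of `K`. -/
def LocallyIsomorphic (L K : DecComplex D) : Prop :=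
  ∀ P : Set L.T, P.Finite →
    ∃ Q : Set K.T, Q.Finite ∧ Nonempty (Iso (L.restrict P) (K.restrict Q))

/-- The homeomorphism `φ : A_aff → B_aff` is cell-preserving and decoration-preserving, and maps each
cell isometrically, `f` being the map that it induces on the cells. -/
structure IsAffIso {A B : DecComplex D} (f : Iso A B) (φ : A.Aff ≃ₜ B.Aff) : Prop where
  vertex : ∀ v, φ '' A.vertexCell v = B.vertexCell (f.onV v)
  edge : ∀ e, φ '' A.edgeCell e = B.edgeCell (f.onE e)
  tile : ∀ t, ∃ g : PentComplex.RegPentagon ≃ᵢ PentComplex.RegPentagon,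
    ∀ p, φ (A.pt t p) = B.pt (f.onT t) (g p)

theorem IsAffIso.refl (A : DecComplex D) : IsAffIso (Iso.refl A) (Homeomorph.refl A.Aff) where
  vertex v := by simp [Iso.refl]
  edge e := by simp [Iso.refl]
  tile t := ⟨IsometryEquiv.refl _, fun _ => rfl⟩

theorem IsAffIso.trans {A B C : DecComplex D} {f : Iso A B} {g : Iso B C} {φ : A.Aff ≃ₜ B.Aff}
    {ψ : B.Aff ≃ₜ C.Aff} (hφ : IsAffIso f φ) (hψ : IsAffIso g ψ) :
    IsAffIso (f.trans g) (φ.trans ψ) where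
  vertex v := by
    have h := hψ.vertex (f.onV v)
    rw [← hφ.vertex, Set.image_image] at h
    exact h
  edge e := by
    have h := hψ.edge (f.onE e)
    rw [← hφ.edge, Set.image_image] at h
    exact h
  tile t := by
    obtain ⟨g₁, h₁⟩ := hφ.tile t
    obtain ⟨g₂, h₂⟩ := hψ.tile (f.onT t)
    refine ⟨g₁.trans g₂, fun p => ?_⟩
    change ψ (φ _) = _
    rw [h₁, h₂]; rfl

theorem IsAffIso.symm {A B : DecComplex D} {f : Iso A B} {φ : A.Aff ≃ₜ B.Aff}
    (hφ : IsAffIso f φ) : IsAffIso f.symm φ.symm where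
  vertex v := by
    obtain ⟨v, rfl⟩ := f.onV.surjective v
    rw [← hφ.vertex, Set.image_image]; simp [Iso.symm]
  edge e := by
    obtain ⟨e, rfl⟩ := f.onE.surjective e
    rw [← hφ.edge, Set.image_image]; simp [Iso.symm]
  tile t := by
    obtain ⟨t, rfl⟩ := f.onT.surjective t
    obtain ⟨g, h⟩ := hφ.tile t
    refine ⟨g.symm, fun p => ?_⟩
    rw [Homeomorph.symm_apply_eq]
    simp [Iso.symm, h]

end DecComplex

/-! ### The hulls -/

section Hulls

variable {D : Type u}

/-- The tiling `K` with the decoration `δ`. -/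
def decoratedK (δ : PentComplex.tilingK.V → PentComplex.tilingK.E → PentComplex.tilingK.T → D) :
    DecComplex D :=
  { PentComplex.tilingK with dec := δ }

variable (δ : PentComplex.tilingK.V → PentComplex.tilingK.E → PentComplex.tilingK.T → D)

/-- The (decorated) combinatorial tilings that are locally isomorphic to `K`. -/
structure HullTiling : Type (max 1 u) where
  L : DecComplex D
  isTiling : L.IsTiling
  locallyIsomorphic : L.LocallyIsomorphic (decoratedK δ)

/-- `(L, x) ∼ (L', x')` if some isomorphism `L_aff → L'_aff` that preserves cells and decorations
and is isometric on each cell takes the point `x` to the point `x'`. -/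
def affSetoid : Setoid (Σ L : HullTiling δ, L.L.Aff) where
  r a b := ∃ (f : DecComplex.Iso a.1.L b.1.L) (φ : a.1.L.Aff ≃ₜ b.1.L.Aff),
    DecComplex.IsAffIso f φ ∧ φ a.2 = b.2
  iseqv :=
    { refl := fun a => ⟨_, _, DecComplex.IsAffIso.refl a.1.L, rfl⟩
      symm := by
        rintro a b ⟨f, φ, h, hx⟩
        exact ⟨_, _, h.symm, by rw [← hx, Homeomorph.symm_apply_apply]⟩
      trans := by
        rintro a b c ⟨f, φ, h, hx⟩ ⟨g, ψ, h', hx'⟩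
        exact ⟨_, _, h.trans h', by rw [← hx', ← hx]; rfl⟩ }

/-- The continuous hull `Ω`. -/
def ContHull : Type (max 1 u) := Quotient (affSetoid δ)

/-- `(L, v) ∼ (L', v')` if some combinatorial isomorphism `L → L'` that preserves decorations takes
the vertex `v` to the vertex `v'`. -/
def combSetoid : Setoid (Σ L : HullTiling δ, L.L.V) where
  r a b := ∃ f : DecComplex.Iso a.1.L b.1.L, f.onV a.2 = b.2
  iseqv :=
    { refl := fun a => ⟨DecComplex.Iso.refl a.1.L, rfl⟩
      symm := by
        rintro a b ⟨f, hx⟩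
        exact ⟨f.symm, by rw [← hx]; exact f.onV.symm_apply_apply _⟩
      trans := by
        rintro a b c ⟨f, hx⟩ ⟨g, hx'⟩
        exact ⟨f.trans g, by rw [← hx', ← hx]; rfl⟩ }

/-- The discrete hull `Ξ`. -/
def DiscHull : Type (max 1 u) := Quotient (combSetoid δ)

variable {δ}

/-- The class `[L, x]` of a tiling with a distinguished point. -/
def ContHull.mk (L : HullTiling δ) (x : L.L.Aff) : ContHull δ :=
  Quotient.mk (affSetoid δ) ⟨L, x⟩

/-- The class `[L, v]` of a tiling with a distinguished vertex. -/
def DiscHull.mk (L : HullTiling δ) (v : L.L.V) : DiscHull δ :=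
  Quotient.mk (combSetoid δ) ⟨L, v⟩

/-- The relation `R` on `Ω`: change of the base point within the same tiling. -/
def contRel (a b : ContHull δ) : Prop :=
  ∃ (L : HullTiling δ) (x x' : L.L.Aff), a = ContHull.mk L x ∧ b = ContHull.mk L x'

/-- The relation `R'` on `Ξ`: change of the base vertex within the same tiling. -/
def discRel (a b : DiscHull δ) : Prop :=
  ∃ (L : HullTiling δ) (v v' : L.L.V), a = DiscHull.mk L v ∧ b = DiscHull.mk L v'

end Hulls

/-- `Y` is a full transversal to `X` relative to `R`. -/
def IsFullTransversal {X : Type*} (R : X → X → Prop) (Y : Set X) : Prop :=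
  ∀ x, ({y | R x y} ∩ Y).Countable ∧ ({y | R x y} ∩ Y).Nonempty

/-- The restriction `R_Y` of `R` to `Y`, as a set of pairs. -/
def restrictRel {X : Type*} (R : X → X → Prop) (Y : Set X) : Set (X × X) :=
  {p | p.1 ∈ Y ∧ p.2 ∈ Y ∧ R p.1 p.2}

/-! The heart of the matter is that combinatorial and affine isomorphisms of tilings identify the
same pairs of vertices. An affine isomorphism comes with a map `f` of cells and carries the cell of
`v` to the cell of `f.onV v`. Each vertex cell of a tiling is a single point and distinct vertices
give distinct points, so the affine map takes the point of `v` to the point of `w` exactly when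
`f.onV v = w`.

Conversely, let `f` be a combinatorial isomorphism. Since tiles are embedded, on each tile `f` is an
adjacency-preserving permutation of five corners, hence an element of the dihedral group, and a
linear isometry of the regular pentagon realizes it. On a common edge two such isometries agree,
because each is affine there and the endpoints go where `f` sends them. They therefore paste to a
homeomorphism, whose inverse is pasted from `f.symm` (`Iso.exists_isAffIso`). Both directions meet
in `ContHull.mk_eq_mk_of_mem_vertexCell`, which makes the map from the discrete hull well defined
and injective.

The relation is transitive because every class related to `[L, x]` has a representative in `L`
itself (`contRel_mk_iff`). The same transport, applied to vertices, shows that the class of `[L, x]`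
meets the discrete hull in the classes `[L, w]`, which also identifies the restricted relation.
There are countably many `w`, since the open tiles are disjoint nonempty open sets in a separable
space, and at least one, since the plane is not empty. -/

open scoped ComplexConjugate

namespace PentComplex

/-! ### Geometry of the regular pentagon -/

/-- The primitive fifth root of unity `exp (2πi/5)`. -/
noncomputable def fifthRoot : ℂ := Complex.exp (2 * Real.pi * Complex.I / 5)

theorem fifthRoot_isPrimitive : IsPrimitiveRoot fifthRoot 5 := by
  simpa [fifthRoot] using Complex.isPrimitiveRoot_exp 5 (by norm_num)

theorem norm_fifthRoot : ‖fifthRoot‖ = 1 := fifthRoot_isPrimitive.norm'_eq_one (by norm_num)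

theorem circumradius_pos : 0 < 1 / (2 * Real.sin (Real.pi / 5)) := by
  have : 0 < Real.sin (Real.pi / 5) :=
    Real.sin_pos_of_pos_of_lt_pi (by positivity) (by linarith [Real.pi_pos])
  positivity

theorem regVertex_eq (i : Fin 5) :
    regVertex i = ((1 / (2 * Real.sin (Real.pi / 5)) : ℝ) : ℂ) * fifthRoot ^ (i : ℕ) := by
  rw [regVertex, fifthRoot, ← Complex.exp_nat_mul]
  congr 2
  ring

theorem norm_regVertex (i : Fin 5) :
    ‖regVertex i‖ = 1 / (2 * Real.sin (Real.pi / 5)) := by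
  rw [regVertex_eq, norm_mul, norm_pow, norm_fifthRoot, one_pow, mul_one, Complex.norm_real,
    Real.norm_of_nonneg circumradius_pos.le]

theorem regVertex_injective : Function.Injective regVertex := by
  intro i j h
  rw [regVertex_eq, regVertex_eq] at h
  have h' := mul_left_cancel₀ (Complex.ofReal_ne_zero.2 circumradius_pos.ne') h
  exact Fin.ext (fifthRoot_isPrimitive.pow_inj i.2 j.2 h')

theorem regVertex_add_one (i : Fin 5) : regVertex (i + 1) = fifthRoot * regVertex i := by
  have h : fifthRoot ^ ((i + 1 : Fin 5) : ℕ) = fifthRoot ^ ((i : ℕ) + 1) := by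
    rw [Fin.val_add]
    exact (pow_eq_pow_mod _ fifthRoot_isPrimitive.pow_eq_one).symm
  rw [regVertex_eq, regVertex_eq, h, pow_succ]
  ring

theorem fifthRoot_mul_conj : fifthRoot * conj fifthRoot = 1 := by
  rw [Complex.mul_conj, Complex.normSq_eq_norm_sq, norm_fifthRoot]; simp

theorem regVertex_sub_one (i : Fin 5) : regVertex (i - 1) = conj fifthRoot * regVertex i := by
  have h := regVertex_add_one (i - 1)
  rw [sub_add_cancel] at h
  rw [h, ← mul_assoc, mul_comm (conj fifthRoot), fifthRoot_mul_conj, one_mul]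

theorem regSide_zero (i : Fin 5) : regSide i 0 = regVertex i := by simp [regSide]

theorem regSide_one (i : Fin 5) : regSide i 1 = regVertex (i + 1) := by simp [regSide]

theorem regVertex_add_one_ne (i : Fin 5) : regVertex i ≠ regVertex (i + 1) := by
  have h : ∀ i : Fin 5, i ≠ i + 1 := by decide
  exact regVertex_injective.ne (h i)

/-- By strict convexity of the disc, a point strictly inside a chord has norm less than the
circumradius, while all vertices lie on the circle. -/
theorem regSide_ne_regVertex (i j : Fin 5) {s : ℝ} (h₀ : 0 < s) (h₁ : s < 1) :
    regSide i s ≠ regVertex j := by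
  intro h
  have h' : ‖(1 - s) • regVertex i + s • regVertex (i + 1)‖ < 1 / (2 * Real.sin (Real.pi / 5)) :=
    norm_combo_lt_of_ne (norm_regVertex _).le (norm_regVertex _).le (regVertex_add_one_ne i)
      (by linarith) h₀ (by ring)
  rw [← AffineMap.lineMap_apply_module] at h'
  rw [regSide] at h
  rw [h, norm_regVertex] at h'
  exact lt_irrefl _ h'

/-- After division by the vertex, a zero would give `(1 - s) + s * fifthRoot = 0`. As `fifthRoot` is
not real, `s = 0`, and then `1 = 0`. -/
theorem regSide_ne_zero (i : Fin 5) (s : ℝ) : regSide i s ≠ 0 := by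
  intro h
  rw [regSide, AffineMap.lineMap_apply_module, regVertex_add_one, Complex.real_smul,
    Complex.real_smul] at h
  have h2 : regVertex i * (((1 - s : ℝ) : ℂ) + s * fifthRoot) = 0 := by rw [← h]; ring
  have hv : regVertex i ≠ 0 := by
    rw [← norm_pos_iff, norm_regVertex]; exact circumradius_pos
  have h3 := (mul_eq_zero.1 h2).resolve_left hv
  have him : fifthRoot.im = Real.sin (2 * Real.pi / 5) := by
    have : (2 * Real.pi * Complex.I / 5 : ℂ) = ((2 * Real.pi / 5 : ℝ) : ℂ) * Complex.I := by
      push_cast; ring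
    rw [fifthRoot, this, Complex.exp_ofReal_mul_I_im]
  have hpos : 0 < fifthRoot.im := by
    rw [him]
    exact Real.sin_pos_of_pos_of_lt_pi (by positivity) (by linarith [Real.pi_pos])
  have hi := congrArg Complex.im h3
  have hr := congrArg Complex.re h3
  simp only [Complex.add_im, Complex.ofReal_im, Complex.mul_im, Complex.ofReal_re, zero_mul,
    add_zero, zero_add, Complex.zero_im, Complex.add_re, Complex.mul_re, sub_zero,
    Complex.zero_re] at hi hr
  have hs : s = 0 := (mul_eq_zero.1 hi).resolve_right hpos.ne'
  rw [hs] at hr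
  norm_num at hr

/-- The boundary of the regular pentagon. -/
def regBoundary : Set ℂ := ⋃ i, regSide i '' Set.Icc (0 : ℝ) 1

theorem isClosed_regBoundary : IsClosed regBoundary :=
  (isCompact_iUnion fun i => isCompact_Icc.image
    (show Continuous (regSide i) from AffineMap.lineMap_continuous)).isClosed

theorem regSide_mem_regBoundary (i : Fin 5) {s : ℝ} (hs : s ∈ Set.Icc (0 : ℝ) 1) :
    regSide i s ∈ regBoundary :=
  Set.mem_iUnion.2 ⟨i, s, hs, rfl⟩

theorem regVertex_mem_regBoundary (i : Fin 5) : regVertex i ∈ regBoundary :=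
  regSide_zero i ▸ regSide_mem_regBoundary i (by simp)

theorem zero_notMem_regBoundary : (0 : ℂ) ∉ regBoundary := by
  intro h
  obtain ⟨i, s, -, hs⟩ := Set.mem_iUnion.1 h
  exact regSide_ne_zero i s hs

theorem sum_regVertex : ∑ i, regVertex i = 0 := by
  simp only [regVertex_eq, ← Finset.mul_sum]
  rw [Fin.sum_univ_eq_sum_range (fun k => fifthRoot ^ k),
    fifthRoot_isPrimitive.geom_sum_eq_zero (by norm_num), mul_zero]

/-- The centre is the barycentre of the vertices. It serves as a witness that open tiles are
nonempty. -/
theorem zero_mem_regPentagon : (0 : ℂ) ∈ convexHull ℝ (Set.range regVertex) := by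
  have h := (convex_convexHull ℝ (Set.range regVertex)).sum_mem (t := Finset.univ)
    (w := fun _ : Fin 5 => (1 / 5 : ℝ)) (z := regVertex) (fun _ _ => by norm_num) (by simp)
    (fun i _ => subset_convexHull ℝ _ ⟨i, rfl⟩)
  rwa [← Finset.smul_sum, sum_regVertex, smul_zero] at h

/-- The vertex `i` as a point of the closed regular pentagon. -/
noncomputable def regVertexPt (i : Fin 5) : RegPentagon :=
  ⟨regVertex i, subset_convexHull ℝ _ ⟨i, rfl⟩⟩

/-! ### Symmetries of the regular pentagon -/

theorem cyclic_induction {P : Fin 5 → Prop} (h0 : P 0) (hs : ∀ i, P i → P (i + 1)) (i : Fin 5) :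
    P i := by
  have h1 := hs 0 h0
  have h2 := hs _ h1
  have h3 := hs _ h2
  have h4 := hs _ h3
  fin_cases i
  exacts [h0, h1, h2, h3, h4]

/-- A permutation of the vertices of the pentagon that preserves adjacency either preserves or
reverses the cyclic order. -/
theorem rotation_or_reflection {τ : Fin 5 → Fin 5} (hτ : Function.Injective τ)
    (h : ∀ i, τ (i + 1) = τ i + 1 ∨ τ (i + 1) = τ i - 1) :
    (∀ i, τ (i + 1) = τ i + 1) ∨ ∀ i, τ (i + 1) = τ i - 1 := by
  have hne : ∀ i : Fin 5, i + 1 + 1 ≠ i := by decide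
  -- The first step fixes the direction: a later change of direction would give `τ (i + 1 + 1) = τ
  -- i`, against injectivity.
  rcases h 0 with h0 | h0
  · refine Or.inl (cyclic_induction h0 fun i hi => (h (i + 1)).resolve_right fun hc => hne i (hτ ?_))
    rw [hc, hi, add_sub_cancel_right]
  · refine Or.inr (cyclic_induction h0 fun i hi => (h (i + 1)).resolve_left fun hc => hne i (hτ ?_))
    rw [hc, hi, sub_add_cancel]

/-- Every symmetry of the combinatorial pentagon is induced by a linear isometry. -/
theorem exists_linearIsometryEquiv {τ : Fin 5 → Fin 5}
    (h : (∀ i, τ (i + 1) = τ i + 1) ∨ ∀ i, τ (i + 1) = τ i - 1) :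
    ∃ l : ℂ ≃ₗᵢ[ℝ] ℂ, ∀ i, l (regVertex i) = regVertex (τ i) := by
  have hu : ‖fifthRoot ^ (τ 0 : ℕ)‖ = 1 := by rw [norm_pow, norm_fifthRoot, one_pow]
  -- Rotation by `u` takes vertex `0` to vertex `τ 0`. In the reversing case it is preceded by
  -- conjugation, which fixes vertex `0` and inverts `fifthRoot`.
  let u : Circle := ⟨fifthRoot ^ (τ 0 : ℕ), by simpa [Submonoid.unitSphere] using hu⟩
  have hu' : (u : ℂ) = fifthRoot ^ (τ 0 : ℕ) := rfl
  rcases h with h | h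
  · refine ⟨rotation u, cyclic_induction ?_ fun i hi => ?_⟩
    · rw [rotation_apply, hu', regVertex_eq, regVertex_eq]; simp [mul_comm]
    · rw [rotation_apply] at hi ⊢
      rw [h, regVertex_add_one, regVertex_add_one, ← hi]; ring
  · refine ⟨Complex.conjLIE.trans (rotation u), cyclic_induction ?_ fun i hi => ?_⟩
    · rw [LinearIsometryEquiv.trans_apply, rotation_apply, hu', regVertex_eq, regVertex_eq,
        Complex.conjLIE_apply, map_mul, Complex.conj_ofReal]
      simp [mul_comm]
    · rw [LinearIsometryEquiv.trans_apply, rotation_apply, Complex.conjLIE_apply] at hi ⊢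
      rw [h, regVertex_add_one, regVertex_sub_one, ← hi, map_mul]; ring

/-- A linear isometry that permutes the vertices of the regular pentagon restricts to an isometry
of the pentagon. -/
noncomputable def pentagonIsometry (l : ℂ ≃ₗᵢ[ℝ] ℂ)
    (h : l '' Set.range regVertex = Set.range regVertex) : RegPentagon ≃ᵢ RegPentagon where
  toEquiv := l.toEquiv.subtypeEquiv fun p => by
    have hl : l '' convexHull ℝ (Set.range regVertex) = convexHull ℝ (Set.range regVertex) := by
      conv_rhs => rw [← h]
      exact l.toLinearEquiv.toLinearMap.image_convexHull _
    constructor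
    · intro hp; rw [← hl]; exact ⟨p, hp, rfl⟩
    · intro hp
      rw [← hl] at hp
      obtain ⟨q, hq, hqp⟩ := hp
      rwa [← l.injective hqp]
  isometry_toFun := fun p q => l.isometry p.1 q.1

theorem coe_pentagonIsometry (l : ℂ ≃ₗᵢ[ℝ] ℂ)
    (h : l '' Set.range regVertex = Set.range regVertex) (p : RegPentagon) :
    (pentagonIsometry l h p : ℂ) = l p := rfl

/-! ### Cells of the affine realization -/

section Cells

variable (A : PentComplex)

/-- The vertices at which a point of a tile lies. -/
def verticesAt (x : Σ _ : A.T, RegPentagon) : Set A.V :=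
  {v | ∃ i, A.corner x.1 i = v ∧ x.2.1 = regVertex i}

variable {A}

theorem verticesAt_of_eq_regVertex {t : A.T} {i : Fin 5} {p : RegPentagon}
    (hp : p.1 = regVertex i) : A.verticesAt ⟨t, p⟩ = {A.corner t i} := by
  ext v
  constructor
  · rintro ⟨j, rfl, hj⟩
    rw [regVertex_injective (hp.symm.trans hj)]; rfl
  · rintro rfl
    exact ⟨i, rfl, hp⟩

theorem verticesAt_of_eq_regSide {t : A.T} {i : Fin 5} {s : ℝ} {p : RegPentagon}
    (h₀ : 0 < s) (h₁ : s < 1) (hp : p.1 = regSide i s) : A.verticesAt ⟨t, p⟩ = ∅ := by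
  ext v
  simp only [Set.mem_empty_iff_false, iff_false]
  rintro ⟨j, -, hj⟩
  exact regSide_ne_regVertex i j h₀ h₁ (hp.symm.trans hj)

/-- Equality in the quotient refers to the equivalence relation generated by `Glue`; an invariant of
`Glue` separates points without describing that relation. Side gluings need care only at the
parameters `0` and `1`, where the point is a vertex. -/
theorem verticesAt_eq_of_glue {x y : Σ _ : A.T, RegPentagon} (h : A.Glue x y) :
    A.verticesAt x = A.verticesAt y := by
  cases h with
  | vertex t t' i j p p' h hp hp' =>
    rw [verticesAt_of_eq_regVertex hp, verticesAt_of_eq_regVertex hp', h]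
  | parallel t t' i j s p p' h h₀ h₁ hs hp hp' =>
    rcases hs.1.eq_or_lt with rfl | hs0
    · rw [regSide_zero] at hp hp'
      rw [verticesAt_of_eq_regVertex hp, verticesAt_of_eq_regVertex hp', h₀]
    rcases hs.2.eq_or_lt with rfl | hs1
    · rw [regSide_one] at hp hp'
      rw [verticesAt_of_eq_regVertex hp, verticesAt_of_eq_regVertex hp', h₁]
    rw [verticesAt_of_eq_regSide hs0 hs1 hp, verticesAt_of_eq_regSide hs0 hs1 hp']
  | opposite t t' i j s p p' h h₀ h₁ hs hp hp' =>
    rcases hs.1.eq_or_lt with rfl | hs0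
    · rw [sub_zero, regSide_one] at hp'
      rw [regSide_zero] at hp
      rw [verticesAt_of_eq_regVertex hp, verticesAt_of_eq_regVertex hp', h₀]
    rcases hs.2.eq_or_lt with rfl | hs1
    · rw [sub_self, regSide_zero] at hp'
      rw [regSide_one] at hp
      rw [verticesAt_of_eq_regVertex hp, verticesAt_of_eq_regVertex hp', h₁]
    rw [verticesAt_of_eq_regSide hs0 hs1 hp,
      verticesAt_of_eq_regSide (sub_pos.2 hs1) (by linarith) hp']

/-- The vertices at which a point of the affine realization lies. -/
def affVerticesAt : A.Aff → Set A.V :=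
  Quot.lift A.verticesAt fun _ _ h => verticesAt_eq_of_glue h

theorem affVerticesAt_of_mem_vertexCell {v : A.V} {x : A.Aff} (h : x ∈ A.vertexCell v) :
    affVerticesAt x = {v} := by
  obtain ⟨t, i, p, rfl, hp, rfl⟩ := h
  exact verticesAt_of_eq_regVertex hp

theorem eq_of_mem_vertexCell {v w : A.V} {x : A.Aff} (hv : x ∈ A.vertexCell v)
    (hw : x ∈ A.vertexCell w) : v = w :=
  Set.singleton_injective
    ((affVerticesAt_of_mem_vertexCell hv).symm.trans (affVerticesAt_of_mem_vertexCell hw))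

theorem vertexCell_subsingleton (v : A.V) : (A.vertexCell v).Subsingleton := by
  rintro _ ⟨t, i, p, hv, hp, rfl⟩ _ ⟨t', i', p', hv', hp', rfl⟩
  exact Quot.sound (.vertex t t' i i' p p' (hv.trans hv'.symm) hp hp')

theorem pt_mem_vertexCell (t : A.T) (i : Fin 5) :
    A.pt t (regVertexPt i) ∈ A.vertexCell (A.corner t i) :=
  ⟨t, i, _, rfl, rfl, rfl⟩

/-! ### Existence and countability of vertices -/

theorem IsTiling.vertexCell_nonempty (hA : A.IsTiling) (v : A.V) : (A.vertexCell v).Nonempty := by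
  obtain ⟨t, i, rfl⟩ := hA.exists_corner_eq v
  exact ⟨_, pt_mem_vertexCell t i⟩

theorem IsTiling.nonempty_vertices (hA : A.IsTiling) : Nonempty A.V := by
  obtain ⟨e⟩ := hA.homeo_plane
  obtain ⟨⟨t, -⟩, -⟩ := Quot.exists_rep (e.symm 0)
  exact ⟨A.corner t 0⟩

/-- The interior of the tile `t`, as a predicate on the points of the pentagons. -/
def inTileInterior (t : A.T) (x : Σ _ : A.T, RegPentagon) : Prop :=
  x.1 = t ∧ x.2.1 ∉ regBoundary

/-- Gluing happens only along boundaries, so lying in the interior of a given tile is a property of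
points of the quotient. -/
theorem mem_regBoundary_of_glue {x y : Σ _ : A.T, RegPentagon} (h : A.Glue x y) :
    x.2.1 ∈ regBoundary ∧ y.2.1 ∈ regBoundary := by
  cases h with
  | vertex t t' i j p p' h hp hp' =>
    exact ⟨by simpa only [hp] using regVertex_mem_regBoundary i,
      by simpa only [hp'] using regVertex_mem_regBoundary j⟩
  | parallel t t' i j s p p' h h₀ h₁ hs hp hp' =>
    exact ⟨by simpa only [hp] using regSide_mem_regBoundary i hs,
      by simpa only [hp'] using regSide_mem_regBoundary j hs⟩
  | opposite t t' i j s p p' h h₀ h₁ hs hp hp' =>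
    exact ⟨by simpa only [hp] using regSide_mem_regBoundary i hs,
      by simpa only [hp'] using
        regSide_mem_regBoundary j ⟨sub_nonneg.2 hs.2, by linarith [hs.1]⟩⟩

/-- The open 2-cell `t`. -/
def tileInterior (t : A.T) : Set A.Aff :=
  {x | Quot.lift (inTileInterior t) (fun a b h => by
    simp [inTileInterior, mem_regBoundary_of_glue h]) x}

/-- The preimage in the disjoint union of pentagons is the complement of the boundary in the copy
`t` and is empty in every other copy. -/
theorem isOpen_tileInterior (t : A.T) : IsOpen (tileInterior t) := by
  refine isOpen_coinduced.2 (isOpen_sigma_iff.2 fun t' => ?_)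
  by_cases h : t' = t
  · convert isClosed_regBoundary.isOpen_compl.preimage
      (continuous_subtype_val (p := (· ∈ convexHull ℝ (Set.range regVertex)))) using 1
    ext p
    exact and_iff_right h
  · convert isOpen_empty
    ext p
    exact iff_of_false (fun hp => h hp.1) id

theorem tileInterior_nonempty (t : A.T) : (tileInterior t).Nonempty :=
  ⟨A.pt t ⟨0, zero_mem_regPentagon⟩, rfl, zero_notMem_regBoundary⟩

theorem pairwise_disjoint_tileInterior :
    Pairwise (Function.onFun Disjoint (tileInterior (A := A))) := by
  intro t t' h
  refine Set.disjoint_left.2 fun x hx hx' => h ?_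
  induction x using Quot.ind
  exact hx.1.symm.trans hx'.1

/-- A separable space has only countably many disjoint nonempty open sets, here the open tiles, and
each tile has five corners. -/
theorem IsTiling.countable_vertices (hA : A.IsTiling) : Countable A.V := by
  obtain ⟨e⟩ := hA.homeo_plane
  have : TopologicalSpace.SeparableSpace A.Aff :=
    e.symm.surjective.denseRange.separableSpace e.symm.continuous
  have : Countable A.T := by
    have h := Set.PairwiseDisjoint.countable_of_isOpen (a := Set.univ) (s := tileInterior (A := A))
      (fun t _ t' _ h => pairwise_disjoint_tileInterior h) (fun t _ => isOpen_tileInterior t)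
      (fun t _ => tileInterior_nonempty t)
    exact Set.countable_univ_iff.1 h
  have hs : Function.Surjective fun x : A.T × Fin 5 => A.corner x.1 x.2 := fun v => by
    obtain ⟨t, i, h⟩ := hA.exists_corner_eq v
    exact ⟨(t, i), h⟩
  exact hs.countable

/-- `p` is the point of the tile `t` that lies on the edge `e`, with endpoints `v` and `w`, at
distance `s` from `v`. -/
def OnEdge (A : PentComplex) (t : A.T) (p : RegPentagon) (e : A.E) (v w : A.V) (s : ℝ) : Prop :=
  ∃ k, A.side t k = e ∧
    ((A.corner t k = v ∧ A.corner t (k + 1) = w ∧ p.1 = regSide k s) ∨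
      (A.corner t k = w ∧ A.corner t (k + 1) = v ∧ p.1 = regSide k (1 - s)))

/-- The ordered endpoints and `s` locate the point independently of how either tile numbers its
sides. Equal directions give a `parallel` gluing, different ones an `opposite` gluing. -/
theorem OnEdge.pt_eq {t t' : A.T} {p p' : RegPentagon} {e : A.E} {v w : A.V} {s : ℝ}
    (h : A.OnEdge t p e v w s) (h' : A.OnEdge t' p' e v w s) (hs : s ∈ Set.Icc (0 : ℝ) 1) :
    A.pt t p = A.pt t' p' := by
  have hs' : 1 - s ∈ Set.Icc (0 : ℝ) 1 := ⟨sub_nonneg.2 hs.2, by linarith [hs.1]⟩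
  obtain ⟨k, hk, h⟩ := h
  obtain ⟨k', hk', h'⟩ := h'
  have hkk := hk.trans hk'.symm
  rcases h with ⟨hv, hw, hp⟩ | ⟨hw, hv, hp⟩ <;> rcases h' with ⟨hv', hw', hp'⟩ | ⟨hw', hv', hp'⟩
  · exact Quot.sound (.parallel _ _ k k' s _ _ hkk (hv.trans hv'.symm) (hw.trans hw'.symm) hs hp hp')
  · exact Quot.sound (.opposite _ _ k k' s _ _ hkk (hv.trans hv'.symm) (hw.trans hw'.symm) hs hp hp')
  · exact Quot.sound (.opposite _ _ k k' (1 - s) _ _ hkk (hw.trans hw'.symm) (hv.trans hv'.symm) hs'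
      hp (by rwa [sub_sub_cancel]))
  · exact Quot.sound (.parallel _ _ k k' (1 - s) _ _ hkk (hw.trans hw'.symm) (hv.trans hv'.symm) hs'
      hp hp')

end Cells

end PentComplex

namespace DecComplex

open PentComplex

variable {D : Type u} {A B : DecComplex D}

/-! ### The affine map induced by a combinatorial isomorphism -/

/-- The isometry `g` of the regular pentagon maps the tile `t` to its image under `f` as `f`
prescribes on the vertices and edges. -/
def Iso.IsTileMap (f : Iso A B) (t : A.T) (g : RegPentagon ≃ᵢ RegPentagon) : Prop :=
  ∃ (τ : Fin 5 → Fin 5) (l : ℂ ≃ₗᵢ[ℝ] ℂ), (∀ i, l (regVertex i) = regVertex (τ i)) ∧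
    (∀ p : RegPentagon, (g p : ℂ) = l p) ∧
    (∀ i, B.corner (f.onT t) (τ i) = f.onV (A.corner t i)) ∧
    ∀ i, ∃ k, B.side (f.onT t) k = f.onE (A.side t i) ∧
      ((τ i = k ∧ τ (i + 1) = k + 1) ∨ (τ i = k + 1 ∧ τ (i + 1) = k))

/-- An `Iso` prescribes only the set of sides of a tile; the images of the corners are recovered as
endpoints of the image sides. Injectivity of the corners then makes the induced `τ` an injective map
that preserves adjacency, hence a rotation or a reflection. -/
theorem Iso.exists_isTileMap (f : Iso A B) (hA : ∀ t, Function.Injective (A.corner t))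
    (hB : ∀ t, Function.Injective (B.corner t)) (t : A.T) : ∃ g, f.IsTileMap t g := by
  have hside : ∀ i, ∃ k, B.side (f.onT t) k = f.onE (A.side t i) := fun i => by
    have h : f.onE (A.side t i) ∈ Set.range (B.side (f.onT t)) := by
      rw [f.sides_map]; exact ⟨_, ⟨i, rfl⟩, rfl⟩
    exact h
  choose σ hσ using hside
  have hends : ∀ i, s(B.corner (f.onT t) (σ i), B.corner (f.onT t) (σ i + 1)) =
      s(f.onV (A.corner t i), f.onV (A.corner t (i + 1))) := fun i => by
    rw [← B.ends_side, hσ, f.ends_map, A.ends_side, Sym2.map_mk]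
  have hcorner : ∀ i, ∃ k, B.corner (f.onT t) k = f.onV (A.corner t i) := fun i => by
    rcases Sym2.eq_iff.1 (hends i) with h | h
    · exact ⟨_, h.1⟩
    · exact ⟨_, h.2⟩
  choose τ hτ using hcorner
  have hinj : Function.Injective τ := fun i j h => by
    apply hA t
    apply f.onV.injective
    rw [← hτ, ← hτ, h]
  have hor : ∀ i, (τ i = σ i ∧ τ (i + 1) = σ i + 1) ∨ (τ i = σ i + 1 ∧ τ (i + 1) = σ i) := by
    intro i
    have h := hends i
    rw [← hτ, ← hτ] at h
    rcases Sym2.eq_iff.1 h with h | h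
    · exact Or.inl ⟨(hB _ h.1).symm, (hB _ h.2).symm⟩
    · exact Or.inr ⟨(hB _ h.2).symm, (hB _ h.1).symm⟩
  obtain ⟨l, hl⟩ := exists_linearIsometryEquiv (rotation_or_reflection hinj fun i => by
    rcases hor i with ⟨h, h'⟩ | ⟨h, h'⟩
    · left; rw [h, h']
    · right; rw [h, h', add_sub_cancel_right])
  have himage : l '' Set.range regVertex = Set.range regVertex := by
    rw [← Set.range_comp, show l ∘ regVertex = regVertex ∘ τ from funext hl,
      (Finite.surjective_of_injective hinj).range_comp]
  exact ⟨pentagonIsometry l himage, τ, l, hl, coe_pentagonIsometry l himage, hτ,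
    fun i => ⟨σ i, hσ i, hor i⟩⟩

/-! ### Compatibility of tile maps with the gluing -/

theorem Iso.IsTileMap.map_vertex {f : Iso A B} {t : A.T} {g : RegPentagon ≃ᵢ RegPentagon}
    (h : f.IsTileMap t g) {p : RegPentagon} {i : Fin 5} (hp : p.1 = regVertex i) :
    ∃ j, (g p).1 = regVertex j ∧ B.corner (f.onT t) j = f.onV (A.corner t i) := by
  obtain ⟨τ, l, hl, hg, hτ, -⟩ := h
  exact ⟨τ i, by rw [hg, hp, hl], hτ i⟩

theorem regSide_one_sub (k : Fin 5) (s : ℝ) :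
    regSide k (1 - s) = AffineMap.lineMap (regVertex (k + 1)) (regVertex k) s :=
  AffineMap.lineMap_apply_one_sub _ _ _

theorem Iso.IsTileMap.map_side {f : Iso A B} {t : A.T} {g : RegPentagon ≃ᵢ RegPentagon}
    (h : f.IsTileMap t g) {p : RegPentagon} {i : Fin 5} {s : ℝ} (hp : p.1 = regSide i s) :
    B.OnEdge (f.onT t) (g p) (f.onE (A.side t i)) (f.onV (A.corner t i))
      (f.onV (A.corner t (i + 1))) s := by
  obtain ⟨τ, l, hl, hg, hτ, hσ⟩ := h
  obtain ⟨k, hk, h⟩ := hσ i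
  have hgp : (g p).1 = AffineMap.lineMap (regVertex (τ i)) (regVertex (τ (i + 1))) s := by
    rw [hg, hp, regSide, AffineMap.lineMap_apply_module, AffineMap.lineMap_apply_module, map_add,
      map_smul, map_smul, hl, hl]
  refine ⟨k, hk, ?_⟩
  rcases h with ⟨h, h'⟩ | ⟨h, h'⟩
  · left
    rw [← hτ, ← hτ, hgp, h, h']
    exact ⟨rfl, rfl, rfl⟩
  · right
    rw [← hτ, ← hτ, hgp, h, h', regSide_one_sub]
    exact ⟨rfl, rfl, rfl⟩

theorem Iso.IsTileMap.map_onEdge {f : Iso A B} {t : A.T} {g : RegPentagon ≃ᵢ RegPentagon}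
    (h : f.IsTileMap t g) {p : RegPentagon} {e : A.E} {v w : A.V} {s : ℝ}
    (hp : A.OnEdge t p e v w s) :
    B.OnEdge (f.onT t) (g p) (f.onE e) (f.onV v) (f.onV w) s := by
  obtain ⟨k, rfl, ⟨rfl, rfl, hp⟩ | ⟨rfl, rfl, hp⟩⟩ := hp
  · exact h.map_side hp
  -- Here the side runs from `w` to `v`, so `map_side` yields the parameter `1 - s` from `w`.
  -- Reversing the edge exchanges the two alternatives of `OnEdge`.
  · obtain ⟨j, hj, h⟩ := h.map_side hp
    rw [sub_sub_cancel] at h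
    exact ⟨j, hj, h.symm⟩

theorem Iso.IsTileMap.pt_eq_of_glue {f : Iso A B} {g : A.T → RegPentagon ≃ᵢ RegPentagon}
    (hg : ∀ t, f.IsTileMap t (g t)) {x y : Σ _ : A.T, RegPentagon} (h : A.Glue x y) :
    B.pt (f.onT x.1) (g x.1 x.2) = B.pt (f.onT y.1) (g y.1 y.2) := by
  cases h with
  | vertex t t' i j p p' h hp hp' =>
    obtain ⟨k, hk, hk'⟩ := (hg t).map_vertex hp
    obtain ⟨m, hm, hm'⟩ := (hg t').map_vertex hp'
    exact Quot.sound (.vertex _ _ k m _ _ (by rw [hk', hm', h]) hk hm)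
  | parallel t t' i j s p p' h h₀ h₁ hs hp hp' =>
    exact ((hg t).map_onEdge ⟨i, rfl, Or.inl ⟨rfl, rfl, hp⟩⟩).pt_eq
      ((hg t').map_onEdge ⟨j, h.symm, Or.inl ⟨h₀.symm, h₁.symm, hp'⟩⟩) hs
  | opposite t t' i j s p p' h h₀ h₁ hs hp hp' =>
    exact ((hg t).map_onEdge ⟨i, rfl, Or.inl ⟨rfl, rfl, hp⟩⟩).pt_eq
      ((hg t').map_onEdge ⟨j, h.symm, Or.inr ⟨h₁.symm, h₀.symm, hp'⟩⟩) hs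

/-- The map of affine realizations that is given by `g t` on the tile `t`. -/
noncomputable def Iso.affMap (f : Iso A B) (g : A.T → RegPentagon ≃ᵢ RegPentagon)
    (hg : ∀ t, f.IsTileMap t (g t)) : A.Aff → B.Aff :=
  Quot.lift (fun x => B.pt (f.onT x.1) (g x.1 x.2)) fun _ _ h => Iso.IsTileMap.pt_eq_of_glue hg h

theorem Iso.continuous_affMap (f : Iso A B) (g : A.T → RegPentagon ≃ᵢ RegPentagon)
    (hg : ∀ t, f.IsTileMap t (g t)) : Continuous (f.affMap g hg) := by
  refine continuous_coinduced_dom.2 (continuous_sigma fun t => ?_)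
  have h : Continuous (B.pt (f.onT t)) := continuous_coinduced_rng.comp continuous_sigmaMk
  exact h.comp (g t).continuous

/-- The families `g` and `g'` are chosen independently, but a tile map is determined by its values
on the vertices: the composite linear map fixes all five, hence their convex hull. -/
theorem Iso.affMap_symm_affMap (hA : ∀ t, Function.Injective (A.corner t)) (f : Iso A B)
    {g : A.T → RegPentagon ≃ᵢ RegPentagon} (hg : ∀ t, f.IsTileMap t (g t))
    {g' : B.T → RegPentagon ≃ᵢ RegPentagon} (hg' : ∀ t, f.symm.IsTileMap t (g' t)) (x : A.Aff) :
    f.symm.affMap g' hg' (f.affMap g hg x) = x := by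
  obtain ⟨⟨t, p⟩, rfl⟩ := Quot.exists_rep x
  change A.pt (f.symm.onT (f.onT t)) (g' (f.onT t) (g t p)) = A.pt t p
  obtain ⟨τ, l, hl, hgl, hτ, -⟩ := hg t
  obtain ⟨τ', l', hl', hgl', hτ', -⟩ := hg' (f.onT t)
  have ht : f.symm.onT (f.onT t) = t := f.onT.symm_apply_apply t
  have hττ : ∀ i, τ' (τ i) = i := fun i => by
    have h := hτ' (τ i)
    rw [hτ, ht] at h
    exact hA t (h.trans (f.onV.symm_apply_apply _))
  have hid : ∀ z ∈ convexHull ℝ (Set.range regVertex), l' (l z) = z := by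
    intro z hz
    have hconv : Convex ℝ {z : ℂ | l' (l z) = z} := by
      intro a ha b hb r s _ _ _
      simp only [Set.mem_ofPred_eq] at ha hb ⊢
      rw [map_add, map_add, map_smul, map_smul, map_smul, map_smul, ha, hb]
    refine convexHull_min ?_ hconv hz
    rintro _ ⟨i, rfl⟩
    simp only [Set.mem_ofPred_eq]
    rw [hl, hl', hττ]
  have hp : g' (f.onT t) (g t p) = p := Subtype.ext (by rw [hgl', hgl, hid _ p.2])
  rw [hp, ht]

theorem Iso.affMap_mem_vertexCell (f : Iso A B) {g : A.T → RegPentagon ≃ᵢ RegPentagon}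
    (hg : ∀ t, f.IsTileMap t (g t)) {v : A.V} {x : A.Aff} (hx : x ∈ A.vertexCell v) :
    f.affMap g hg x ∈ B.vertexCell (f.onV v) := by
  obtain ⟨t, i, p, rfl, hp, rfl⟩ := hx
  obtain ⟨j, hj, hj'⟩ := (hg t).map_vertex hp
  exact ⟨_, j, _, hj', hj, rfl⟩

theorem Iso.affMap_mem_edgeCell (f : Iso A B) {g : A.T → RegPentagon ≃ᵢ RegPentagon}
    (hg : ∀ t, f.IsTileMap t (g t)) {e : A.E} {x : A.Aff} (hx : x ∈ A.edgeCell e) :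
    f.affMap g hg x ∈ B.edgeCell (f.onE e) := by
  obtain ⟨t, i, s, p, rfl, hs, hp, rfl⟩ := hx
  obtain ⟨k, hk, ⟨-, -, h⟩ | ⟨-, -, h⟩⟩ := (hg t).map_side hp
  · exact ⟨_, k, s, _, hk, hs, h, rfl⟩
  · exact ⟨_, k, 1 - s, _, hk, ⟨sub_nonneg.2 hs.2, by linarith [hs.1]⟩, h, rfl⟩

/-- Every combinatorial isomorphism is induced by an isomorphism of affine realizations. -/
theorem Iso.exists_isAffIso (f : Iso A B) (hA : ∀ t, Function.Injective (A.corner t))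
    (hB : ∀ t, Function.Injective (B.corner t)) : ∃ φ : A.Aff ≃ₜ B.Aff, IsAffIso f φ := by
  choose g hg using f.exists_isTileMap hA hB
  choose g' hg' using f.symm.exists_isTileMap hB hA
  -- Since `f.symm.symm` is `f` by definition, the other composite is the same lemma for `f.symm`.
  have hr : ∀ y, f.affMap g hg (f.symm.affMap g' hg' y) = y :=
    Iso.affMap_symm_affMap hB f.symm hg' hg
  refine ⟨⟨⟨f.affMap g hg, f.symm.affMap g' hg', f.affMap_symm_affMap hA hg hg', hr⟩,
    f.continuous_affMap g hg, f.symm.continuous_affMap g' hg'⟩, ?_, ?_, fun t => ⟨g t, fun _ => rfl⟩⟩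
  · intro v
    apply Set.Subset.antisymm
    · rintro _ ⟨x, hx, rfl⟩
      exact f.affMap_mem_vertexCell hg hx
    · intro y hy
      refine ⟨_, ?_, hr y⟩
      have h := f.symm.affMap_mem_vertexCell hg' hy
      rwa [show f.symm.onV (f.onV v) = v from f.onV.symm_apply_apply v] at h
  · intro e
    apply Set.Subset.antisymm
    · rintro _ ⟨x, hx, rfl⟩
      exact f.affMap_mem_edgeCell hg hx
    · intro y hy
      refine ⟨_, ?_, hr y⟩
      have h := f.symm.affMap_mem_edgeCell hg' hy
      rwa [show f.symm.onE (f.onE e) = e from f.onE.symm_apply_apply e] at h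

end DecComplex

/-! ### The hulls -/

section

variable {D : Type u}
  {δ : PentComplex.tilingK.V → PentComplex.tilingK.E → PentComplex.tilingK.T → D}

theorem ContHull.mk_eq_mk {L M : HullTiling δ} {x : L.L.Aff} {y : M.L.Aff} :
    ContHull.mk L x = ContHull.mk M y ↔
      ∃ (f : DecComplex.Iso L.L M.L) (φ : L.L.Aff ≃ₜ M.L.Aff),
        DecComplex.IsAffIso f φ ∧ φ x = y :=
  Quotient.eq (r := affSetoid δ)

theorem DiscHull.mk_eq_mk {L M : HullTiling δ} {v : L.L.V} {w : M.L.V} :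
    DiscHull.mk L v = DiscHull.mk M w ↔ ∃ f : DecComplex.Iso L.L M.L, f.onV v = w :=
  Quotient.eq (r := combSetoid δ)

theorem ContHull.exists_rep (a : ContHull δ) : ∃ L x, a = ContHull.mk L x := by
  obtain ⟨⟨L, x⟩, rfl⟩ := Quotient.exists_rep a
  exact ⟨L, x, rfl⟩

theorem DiscHull.exists_rep (a : DiscHull δ) : ∃ L v, a = DiscHull.mk L v := by
  obtain ⟨⟨L, v⟩, rfl⟩ := Quotient.exists_rep a
  exact ⟨L, v, rfl⟩

/-- A class that is related to `[L, x]` is the class of a point of the same tiling `L`. -/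
theorem contRel_mk_iff {L : HullTiling δ} {x : L.L.Aff} {b : ContHull δ} :
    contRel (ContHull.mk L x) b ↔ ∃ y, b = ContHull.mk L y := by
  constructor
  · rintro ⟨M, z, z', h, rfl⟩
    obtain ⟨f, φ, hφ, -⟩ := ContHull.mk_eq_mk.1 h.symm
    -- The isomorphism that identifies the first base points also carries the second one into `L`.
    exact ⟨φ z', ContHull.mk_eq_mk.2 ⟨f, φ, hφ, rfl⟩⟩
  · rintro ⟨y, rfl⟩
    exact ⟨L, x, y, rfl, rfl⟩

theorem contRel_equivalence : Equivalence (contRel (δ := δ)) where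
  refl a := by
    obtain ⟨L, x, rfl⟩ := a.exists_rep
    exact ⟨L, x, x, rfl, rfl⟩
  symm := by
    rintro a b ⟨L, x, y, ha, hb⟩
    exact ⟨L, y, x, hb, ha⟩
  trans := by
    rintro a b c ⟨L, x, y, rfl, rfl⟩ h
    obtain ⟨z, rfl⟩ := contRel_mk_iff.1 h
    exact ⟨L, x, z, rfl, rfl⟩

/-- From left to right, disjointness of vertex cells forces `f.onV v = w`; from right to left, `f`
is realized affinely and the cell of `w` has only one point. -/
theorem ContHull.mk_eq_mk_of_mem_vertexCell {L M : HullTiling δ} {v : L.L.V} {w : M.L.V}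
    {x : L.L.Aff} {y : M.L.Aff} (hx : x ∈ L.L.vertexCell v) (hy : y ∈ M.L.vertexCell w) :
    ContHull.mk L x = ContHull.mk M y ↔ DiscHull.mk L v = DiscHull.mk M w := by
  rw [ContHull.mk_eq_mk, DiscHull.mk_eq_mk]
  constructor
  · rintro ⟨f, φ, hφ, rfl⟩
    refine ⟨f, PentComplex.eq_of_mem_vertexCell ?_ hy⟩
    rw [← hφ.vertex]
    exact ⟨x, hx, rfl⟩
  · rintro ⟨f, rfl⟩
    obtain ⟨φ, hφ⟩ := f.exists_isAffIso L.isTiling.corner_injective M.isTiling.corner_injective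
    refine ⟨f, φ, hφ, PentComplex.vertexCell_subsingleton _ ?_ hy⟩
    rw [← hφ.vertex]
    exact ⟨x, hx, rfl⟩

/-- The inclusion `[L, v] ↦ [L, v]` of the discrete hull into the continuous hull. -/
noncomputable def DiscHull.toContHull : DiscHull δ → ContHull δ :=
  Quotient.lift
    (fun a : Σ L : HullTiling δ, L.L.V =>
      ContHull.mk a.1 (a.1.isTiling.vertexCell_nonempty a.2).some)
    fun _ _ h => (ContHull.mk_eq_mk_of_mem_vertexCell (Set.Nonempty.some_mem _)
      (Set.Nonempty.some_mem _)).2 (Quotient.sound (s := combSetoid δ) h)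

theorem DiscHull.toContHull_mk (L : HullTiling δ) (v : L.L.V) (x : L.L.Aff)
    (hx : x ∈ L.L.vertexCell v) : (DiscHull.mk L v).toContHull = ContHull.mk L x :=
  (ContHull.mk_eq_mk_of_mem_vertexCell (Set.Nonempty.some_mem _) hx).2 rfl

theorem DiscHull.toContHull_injective :
    Function.Injective (DiscHull.toContHull (δ := δ)) := by
  intro a b h
  obtain ⟨L, v, rfl⟩ := a.exists_rep
  obtain ⟨M, w, rfl⟩ := b.exists_rep
  exact (ContHull.mk_eq_mk_of_mem_vertexCell (Set.Nonempty.some_mem _)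
    (Set.Nonempty.some_mem _)).1 h

/-- If `b = [M, v]`, the relation provides an isomorphism from `M` to `L`, and `w` is the image of
`v`. Only the map of cells matters here. -/
theorem contRel_mk_toContHull_iff {L : HullTiling δ} {x : L.L.Aff} {b : DiscHull δ} :
    contRel (ContHull.mk L x) b.toContHull ↔ ∃ w, b = DiscHull.mk L w := by
  rw [contRel_mk_iff]
  constructor
  · rintro ⟨y, h⟩
    obtain ⟨M, v, rfl⟩ := b.exists_rep
    obtain ⟨z, hz⟩ := M.isTiling.vertexCell_nonempty v
    rw [DiscHull.toContHull_mk M v z hz] at h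
    obtain ⟨f, -, -, -⟩ := ContHull.mk_eq_mk.1 h
    exact ⟨f.onV v, DiscHull.mk_eq_mk.2 ⟨f, rfl⟩⟩
  · rintro ⟨w, rfl⟩
    obtain ⟨y, hy⟩ := L.isTiling.vertexCell_nonempty w
    exact ⟨y, DiscHull.toContHull_mk L w y hy⟩

theorem contRel_toContHull_iff {a b : DiscHull δ} :
    contRel a.toContHull b.toContHull ↔ discRel a b := by
  constructor
  · intro h
    obtain ⟨L, v, rfl⟩ := a.exists_rep
    obtain ⟨x, hx⟩ := L.isTiling.vertexCell_nonempty v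
    rw [DiscHull.toContHull_mk L v x hx] at h
    obtain ⟨w, rfl⟩ := contRel_mk_toContHull_iff.1 h
    exact ⟨L, v, w, rfl, rfl⟩
  · rintro ⟨L, v, w, rfl, rfl⟩
    obtain ⟨x, hx⟩ := L.isTiling.vertexCell_nonempty v
    rw [DiscHull.toContHull_mk L v x hx]
    exact contRel_mk_toContHull_iff.2 ⟨w, rfl⟩

/-- The intersection is the image of the vertex set of one tiling `L`. The map from vertices to
classes may fail to be injective when `L` has symmetries, but countability needs only surjectivity.
-/
theorem isFullTransversal_range_toContHull :
    IsFullTransversal (contRel (δ := δ)) (Set.range DiscHull.toContHull) := by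
  intro a
  obtain ⟨L, x, rfl⟩ := a.exists_rep
  constructor
  · have := L.isTiling.countable_vertices
    refine (Set.countable_range fun w : L.L.V => (DiscHull.mk L w).toContHull).mono ?_
    rintro _ ⟨h, b, rfl⟩
    obtain ⟨w, rfl⟩ := contRel_mk_toContHull_iff.1 h
    exact ⟨w, rfl⟩
  · obtain ⟨v⟩ := L.isTiling.nonempty_vertices
    exact ⟨_, contRel_mk_toContHull_iff.2 ⟨v, rfl⟩, _, rfl⟩

end

theorem lemmal {D : Type u}
    (δ : PentComplex.tilingK.V → PentComplex.tilingK.E → PentComplex.tilingK.T → D) :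
    Equivalence (contRel (δ := δ)) ∧
    ∃ j : DiscHull δ → ContHull δ,
      (∀ (L : HullTiling δ) (v : L.L.V) (x : L.L.Aff), x ∈ L.L.vertexCell v →
        j (DiscHull.mk L v) = ContHull.mk L x) ∧
      Function.Injective j ∧
      IsFullTransversal (contRel (δ := δ)) (Set.range j) ∧
      restrictRel (contRel (δ := δ)) (Set.range j) =
        Prod.map j j '' {p : DiscHull δ × DiscHull δ | discRel p.1 p.2} := by
  refine ⟨contRel_equivalence, DiscHull.toContHull, DiscHull.toContHull_mk,
    DiscHull.toContHull_injective, isFullTransversal_range_toContHull, Set.ext ?_⟩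
  rintro ⟨_, _⟩
  constructor
  · rintro ⟨⟨a, rfl⟩, ⟨b, rfl⟩, h⟩
    exact ⟨(a, b), contRel_toContHull_iff.1 h, rfl⟩
  · rintro ⟨⟨a, b⟩, h, heq⟩
    obtain ⟨rfl, rfl⟩ := Prod.ext_iff.1 heq
    exact ⟨⟨a, rfl⟩, ⟨b, rfl⟩, contRel_toContHull_iff.2 h⟩
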